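/- Let $\mathbf R_+=(0,\infty)$ and let $W(\mathbf R_+)$ be the set of all $w\in C^1(\mathbf R_+)$ with $w>0$ such that $\lim_{t\to0^+}w(t)$ exists in $[0,\infty]$. Let $P(\mathbf R_+)$ be the set of $w\in W(\mathbf R_+)$ with $1/w\notin L^1((0,\delta))$ for some $\delta>0$, and let $Q(\mathbf R_+)$ be the set of $w\in W(\mathbf R_+)$ with $1/w\in L^1((0,\delta))$ for every $\delta>0$; thus $W(\mathbf R_+)$ is the disjoint union of $P(\mathbf R_+)$ and $Q(\mathbf R_+)$. For $w\in W(\mathbf R_+)$, $\mu>0$ and $\eta>0$ put $$f_\eta(t)=\begin{cases}\mu+\int_t^\eta\frac{ds}{w(s)}, & w\in P(\mathbf R_+),\\[2pt] \int_0^t\frac{ds}{w(s)}, & w\in Q(\mathbf R_+),\end{cases}\qquad 0<t\le\eta .$$ Let $\tilde\eta=1/f_\eta(\eta)=1/\mu$ if $w\in P(\mathbf R_+)$ and $\tilde\eta=f_\eta(\eta)$ if $w\in Q(\mathbf R_+)$. For $0<\rho\le\tilde\eta$ let $\varphi(\rho)\in(0,\eta]$ be the unique solution of $f_\eta(\varphi(\rho))=\rho^{-1}$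 if $w\in P(\mathbf R_+)$, and of $f_\eta(\varphi(\rho))=\rho$ if $w\in Q(\mathbf R_+)$. Put $$H(\rho)=\frac{\rho\,\varphi'(\rho)}{\varphi(\rho)},\qquad 0<\rho<\tilde\eta .$$ **Theorem.** Let $n>1$ be an integer, $1<p<q<\infty$, $0\le\frac1p-\frac1q\le\frac1n$, $\mu>0$, $\eta>0$, $w\in W(\mathbf R_+)$, $p'=p/(p-1)$, and $B_\eta=\{x\in\mathbf R^n:|x|<\eta\}$. If $\lim_{\rho\to0^+}H(\rho)=0$, then there is no constant $C>0$ such that $$\int_{B_\eta}|\nabla u|^p\,w(|x|)^{p-1}|x|^{1-n}\,dx\ \ge\ C\left(\int_{B_\eta}\frac{|u|^q\,|x|^{1-n}}{w(|x|)\,f_\eta(|x|)^{1+q/p'}}\,dx\right)^{p/q}$$ holds for all real-valued $u\in C_c^\infty(B_\eta\setminus\{0\})$. -/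

import Mathlib

noncomputable section

namespace CKN

open Set Filter MeasureTheory
open scoped Topology ENNReal ContDiff

/-- The class `W(ℝ₊)` of weights: `w` is `C¹` and positive on `(0, ∞)`, and has a limit in `[0, ∞]`
at `0+`. Only the values of `w` on `(0, ∞)` matter. -/
def classW : Set (ℝ → ℝ) :=
  {w | ContDiffOn ℝ 1 w (Ioi 0) ∧ (∀ t, 0 < t → 0 < w t) ∧
    ∃ a : ℝ≥0∞, Tendsto (fun t => ENNReal.ofReal (w t)) (𝓝[>] 0) (𝓝 a)}

/-- The subclass `P(ℝ₊)`: `1/w` is not integrable on `(0, δ)` for some `δ > 0`. -/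
def classP : Set (ℝ → ℝ) :=
  {w | w ∈ classW ∧ ∃ δ : ℝ, 0 < δ ∧ ¬ IntegrableOn (fun s => (w s)⁻¹) (Ioo 0 δ)}

/-- The subclass `Q(ℝ₊)`: `1/w` is integrable on `(0, δ)` for every `δ > 0`. -/
def classQ : Set (ℝ → ℝ) :=
  {w | w ∈ classW ∧ ∀ δ : ℝ, 0 < δ → IntegrableOn (fun s => (w s)⁻¹) (Ioo 0 δ)}

/-- `W(ℝ₊) = P(ℝ₊) ∪ Q(ℝ₊)`. -/
theorem classW_eq : classW = classP ∪ classQ := by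
  ext w
  by_cases h : ∃ δ : ℝ, 0 < δ ∧ ¬ IntegrableOn (fun s => (w s)⁻¹) (Ioo 0 δ)
  · have h' : ¬ ∀ δ : ℝ, 0 < δ → IntegrableOn (fun s => (w s)⁻¹) (Ioo 0 δ) := by
      push Not
      exact h
    simp only [classP, classQ, mem_union, mem_ofPred_eq, h, h', and_true, and_false, or_false]
  · have h' : ∀ δ : ℝ, 0 < δ → IntegrableOn (fun s => (w s)⁻¹) (Ioo 0 δ) := by
      push Not at h
      exact h
    simp only [classP, classQ, mem_union, mem_ofPred_eq, h, and_false, false_or]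
    exact ⟨fun hw => ⟨hw, h'⟩, fun hw => hw.1⟩

/-- `P(ℝ₊) ∩ Q(ℝ₊) = ∅`, so that the case distinctions below are exactly between `w ∈ P(ℝ₊)` and
`w ∈ Q(ℝ₊)` for `w ∈ W(ℝ₊)`. -/
theorem classP_inter_classQ : classP ∩ classQ = ∅ := by
  ext w
  simp only [mem_inter_iff, mem_empty_iff_false, iff_false, not_and]
  rintro ⟨-, δ, hδ, h⟩ ⟨-, h'⟩
  exact h (h' δ hδ)

open Classical in
/-- `f_η(t) = μ + ∫_t^η ds / w(s)` if `w ∈ P(ℝ₊)`, and `f_η(t) = ∫_0^t ds / w(s)` otherwise, i.e. for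
`w ∈ Q(ℝ₊)`. -/
def f (w : ℝ → ℝ) (μ η t : ℝ) : ℝ :=
  if w ∈ classP then μ + ∫ s in t..η, (w s)⁻¹ else ∫ s in (0 : ℝ)..t, (w s)⁻¹

open Classical in
/-- `φ(ρ)` is the solution `t ∈ (0, η]` of `ρ⁻¹ = μ + ∫_t^η ds / w(s)` if `w ∈ P(ℝ₊)`, and of
`ρ = ∫_0^t ds / w(s)` if `w ∈ Q(ℝ₊)`. For `0 < ρ ≤ φ⁻¹(η)` there is exactly one such `t`. -/
def phi (w : ℝ → ℝ) (μ η ρ : ℝ) : ℝ :=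
  if w ∈ classP then Function.invFunOn (f w μ η) (Ioc 0 η) ρ⁻¹
  else Function.invFunOn (f w μ η) (Ioc 0 η) ρ

/-- `H(ρ) = ρ φ'(ρ) / φ(ρ)`. -/
def H (w : ℝ → ℝ) (μ η ρ : ℝ) : ℝ :=
  ρ * deriv (phi w μ η) ρ / phi w μ η ρ

/-- `u ∈ C_c^∞(B_η \ {0})`, with `B_η` the open ball of radius `η` about the origin of `ℝⁿ`. -/
def IsTestFunction (n : ℕ) (η : ℝ) (u : EuclideanSpace ℝ (Fin n) → ℝ) : Prop :=
  ContDiff ℝ ∞ u ∧ HasCompactSupport u ∧ tsupport u ⊆ Metric.ball 0 η \ {0}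

/-- The weighted Caffarelli-Kohn-Nirenberg type inequality with constant `C`, where
`p' = p / (p - 1)`:
`∫_{B_η} |∇u|^p w(|x|)^(p-1) |x|^(1-n) dx
  ≥ C (∫_{B_η} |u|^q |x|^(1-n) / (w(|x|) f_η(|x|)^(1+q/p')) dx)^(p/q)`
for all `u ∈ C_c^∞(B_η \ {0})`. Both integrands are bounded with compact support in
`B_η \ {0}`, hence integrable. -/
def CKNInequality (n : ℕ) (p q : ℝ) (w : ℝ → ℝ) (μ η C : ℝ) : Prop :=
  ∀ u : EuclideanSpace ℝ (Fin n) → ℝ, IsTestFunction n η u →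
    C * (∫ x in Metric.ball (0 : EuclideanSpace ℝ (Fin n)) η,
        |u x| ^ q * ‖x‖ ^ (1 - (n : ℝ)) /
          (w ‖x‖ * f w μ η ‖x‖ ^ (1 + q / (p / (p - 1))))) ^ (p / q)
      ≤ ∫ x in Metric.ball (0 : EuclideanSpace ℝ (Fin n)) η,
        ‖gradient u x‖ ^ p * w ‖x‖ ^ (p - 1) * ‖x‖ ^ (1 - (n : ℝ))

end CKN

end

/-! Test the inequality on products `u(x) = k(|x|) ψ(x/|x|)`, where `ψ` is a bump on a small
spherical cap of measure `m` and `k` is a cutoff to a shell on which `f_η` is comparable to a number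
`l`.

The radial derivative is of size `1/(l w)`, the angular one of size `L/|x|` with `L` the Lipschitz
constant of `ψ`. Their ratio is of order `L w f_η/|x|`. Substituting `ρ = f_η(r)` (class `Q`) or `ρ
= 1/f_η(r)` (class `P`) gives `H(ρ) = w(r) f_η(r)/r` (`tendsto_weight_mul_f_div`). Hence, once the
cap is fixed, `H → 0` makes the angular derivative negligible on shells close to the origin.

In polar coordinates the factor `|x|^(1-n)` cancels the Jacobian, and `∫ dr/w` over the shell is a
multiple of `l`. The gradient side is then at most a constant times `m l^(1-p)`, and the other side
at least a constant times `(m l^(-q/p'))^(p/q) = m^(p/q) l^(1-p)`. The powers of `l` cancel, which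
leaves `m^(p/q) ≤ K m` with `K` independent of the cap (`exists_cap_inequality`). Since `p < q`,
this fails as `m → 0`, and `exists_small_cap` supplies such caps because `n > 1`. -/

noncomputable section

namespace CKN

open Set Filter MeasureTheory
open scoped Topology ENNReal ContDiff NNReal

/-! ### Mollification of `C¹` functions on the line. -/

section SmoothApproximation

/-- A compactly supported `C¹` function on the line is approximated by smooth functions, uniformly
together with its derivative, with an arbitrarily small enlargement of the support. -/
theorem exists_contDiff_approx_deriv {g : ℝ → ℝ} (hg : ContDiff ℝ 1 g) {a b : ℝ}
    (hsupp : ∀ x ∉ Icc a b, g x = 0) {ε δ : ℝ} (hε : 0 < ε) (hδ : 0 < δ) :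
    ∃ k : ℝ → ℝ, ContDiff ℝ ∞ k ∧ (∀ x ∉ Icc (a - δ) (b + δ), k x = 0) ∧
      (∀ x, |k x - g x| ≤ ε) ∧ ∀ x, |deriv k x - deriv g x| ≤ ε := by
  have hcg : HasCompactSupport g := HasCompactSupport.intro isCompact_Icc hsupp
  have hcont' : Continuous (deriv g) := hg.continuous_deriv le_rfl
  have huc : UniformContinuous g := hcg.uniformContinuous_of_continuous hg.continuous
  have huc' : UniformContinuous (deriv g) := hcg.deriv.uniformContinuous_of_continuous hcont'
  obtain ⟨r₁, hr₁, h₁⟩ := Metric.uniformContinuous_iff.mp huc ε hε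
  obtain ⟨r₂, hr₂, h₂⟩ := Metric.uniformContinuous_iff.mp huc' ε hε
  have hr : 0 < min δ (min r₁ r₂) := lt_min hδ (lt_min hr₁ hr₂)
  set r := min δ (min r₁ r₂)
  have hrδ : r ≤ δ := min_le_left _ _
  have hrr₁ : r ≤ r₁ := (min_le_right _ _).trans (min_le_left _ _)
  have hrr₂ : r ≤ r₂ := (min_le_right _ _).trans (min_le_right _ _)
  -- Only the outer radius `r` matters: it bounds the enlargement of the support and is a modulus of
  -- continuity for both `g` and its derivative.
  let φ : ContDiffBump (0 : ℝ) := ⟨r / 2, r, half_pos hr, half_lt_self hr⟩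
  have hd : ∀ x, deriv (convolution (φ.normed volume) g (.lsmul ℝ ℝ) volume) x
      = convolution (φ.normed volume) (deriv g) (.lsmul ℝ ℝ) volume x := fun x =>
    (hcg.hasDerivAt_convolution_right _ φ.continuous_normed.locallyIntegrable hg x).deriv
  refine ⟨convolution (φ.normed volume) g (.lsmul ℝ ℝ) volume, ?_, ?_, ?_, ?_⟩
  · exact φ.hasCompactSupport_normed.contDiff_convolution_left _ φ.contDiff_normed
      hg.continuous.locallyIntegrable
  · intro x hx
    by_contra hne
    obtain ⟨y, hy, z, hz, rfl⟩ := support_convolution_subset _ (Function.mem_support.2 hne)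
    rw [φ.support_normed_eq, Metric.mem_ball, dist_zero_right, Real.norm_eq_abs, abs_lt] at hy
    have hz' : z ∈ Icc a b := by
      by_contra h
      exact hz (hsupp z h)
    have hyr : -r < y ∧ y < r := hy
    exact hx ⟨by linarith [hz'.1], by linarith [hz'.2]⟩
  · intro x
    exact φ.dist_normed_convolution_le hg.continuous.aestronglyMeasurable
      fun y hy => (h₁ (lt_of_lt_of_le hy hrr₁)).le
  · intro x
    rw [hd]
    exact φ.dist_normed_convolution_le hcont'.aestronglyMeasurable
      fun y hy => (h₂ (lt_of_lt_of_le hy hrr₂)).le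

end SmoothApproximation

/-! ### The function `f_η`, its limit at the origin, its relation to `H`, and its level shells. -/

section Weights

variable {w : ℝ → ℝ} {μ η : ℝ}

theorem continuousOn_inv_weight (hw : w ∈ classW) :
    ContinuousOn (fun s => (w s)⁻¹) (Ioi 0) :=
  hw.1.continuousOn.inv₀ fun t ht => (hw.2.1 t ht).ne'

theorem intervalIntegrable_inv_weight (hw : w ∈ classW) {a b : ℝ} (ha : 0 < a) (hb : 0 < b) :
    IntervalIntegrable (fun s => (w s)⁻¹) volume a b :=
  ((continuousOn_inv_weight hw).mono fun _ hx => (lt_min ha hb).trans_le hx.1).intervalIntegrable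

theorem hasStrictDerivAt_f_of_classP (hw : w ∈ classP) (hη : 0 < η) {r : ℝ} (hr : 0 < r) :
    HasStrictDerivAt (f w μ η) (-1 / w r) r := by
  have hc := continuousOn_inv_weight hw.1
  have h := (intervalIntegral.integral_hasStrictDerivAt_left
    (intervalIntegrable_inv_weight hw.1 hr hη)
    (hc.stronglyMeasurableAtFilter isOpen_Ioi r hr)
    (hc.continuousAt (Ioi_mem_nhds hr))).const_add μ
  have hf : f w μ η = fun t => μ + ∫ s in t..η, (w s)⁻¹ := by
    ext t; simp [f, hw]
  rw [hf, neg_div, one_div]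
  exact h

theorem intervalIntegrable_of_classQ (hw : w ∈ classQ) {b : ℝ} (hb : 0 < b) :
    IntervalIntegrable (fun s => (w s)⁻¹) volume 0 b :=
  (intervalIntegrable_iff_integrableOn_Ioo_of_le hb.le).2 (hw.2 b hb)

theorem notMem_classP_of_classQ (hw : w ∈ classQ) : w ∉ classP := fun h =>
  (classP_inter_classQ ▸ (⟨h, hw⟩ : w ∈ classP ∩ classQ) : w ∈ (∅ : Set (ℝ → ℝ)))

theorem f_of_classQ (hw : w ∈ classQ) : f w μ η = fun t => ∫ s in (0 : ℝ)..t, (w s)⁻¹ := by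
  ext t; simp [f, notMem_classP_of_classQ hw]

theorem f_of_classP (hw : w ∈ classP) : f w μ η = fun t => μ + ∫ s in t..η, (w s)⁻¹ := by
  ext t; simp [f, hw]

theorem hasStrictDerivAt_f_of_classQ (hw : w ∈ classQ) {r : ℝ} (hr : 0 < r) :
    HasStrictDerivAt (f w μ η) (1 / w r) r := by
  have hc := continuousOn_inv_weight hw.1
  rw [f_of_classQ hw, one_div]
  exact intervalIntegral.integral_hasStrictDerivAt_right
    (intervalIntegrable_of_classQ hw hr)
    (hc.stronglyMeasurableAtFilter isOpen_Ioi r hr) (hc.continuousAt (Ioi_mem_nhds hr))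

theorem strictAntiOn_f_of_classP (hw : w ∈ classP) (hη : 0 < η) :
    StrictAntiOn (f w μ η) (Ioi 0) := by
  refine strictAntiOn_of_deriv_neg (convex_Ioi 0) (fun r hr =>
    (hasStrictDerivAt_f_of_classP hw hη hr).hasDerivAt.continuousAt.continuousWithinAt) ?_
  intro r hr
  rw [interior_Ioi] at hr
  rw [(hasStrictDerivAt_f_of_classP hw hη hr).hasDerivAt.deriv]
  exact div_neg_of_neg_of_pos (by norm_num) (hw.1.2.1 r hr)

theorem strictMonoOn_f_of_classQ (hw : w ∈ classQ) : StrictMonoOn (f w μ η) (Ioi 0) := by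
  refine strictMonoOn_of_deriv_pos (convex_Ioi 0) (fun r hr =>
    (hasStrictDerivAt_f_of_classQ hw hr).hasDerivAt.continuousAt.continuousWithinAt) ?_
  intro r hr
  rw [interior_Ioi] at hr
  rw [(hasStrictDerivAt_f_of_classQ hw hr).hasDerivAt.deriv]
  exact div_pos one_pos (hw.1.2.1 r hr)

theorem f_pos_of_classP (hw : w ∈ classP) (hμ : 0 < μ) {r : ℝ} (hr : 0 < r) (hrη : r ≤ η) :
    0 < f w μ η r := by
  rw [f_of_classP hw]
  refine add_pos_of_pos_of_nonneg hμ (intervalIntegral.integral_nonneg hrη fun s hs => ?_)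
  exact (inv_pos.2 (hw.1.2.1 s (hr.trans_le hs.1))).le

theorem f_pos_of_classQ (hw : w ∈ classQ) {r : ℝ} (hr : 0 < r) : 0 < f w μ η r := by
  rw [f_of_classQ hw]
  exact intervalIntegral.intervalIntegral_pos_of_pos_on (intervalIntegrable_of_classQ hw hr)
    (fun s hs => inv_pos.2 (hw.1.2.1 s hs.1)) hr

theorem tendsto_f_of_classQ (hw : w ∈ classQ) : Tendsto (f w μ η) (𝓝[>] 0) (𝓝[>] 0) := by
  refine tendsto_nhdsWithin_iff.2 ⟨?_, ?_⟩
  · have h := intervalIntegral.continuousOn_primitive_interval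
      (μ := volume) (f := fun s => (w s)⁻¹) (a := 0) (b := 1)
      (by
        rw [uIcc_of_le zero_le_one, integrableOn_Icc_iff_integrableOn_Ioo]
        exact hw.2 1 one_pos)
    have h0 := h 0 (by simp)
    rw [ContinuousWithinAt, intervalIntegral.integral_same, uIcc_of_le zero_le_one] at h0
    rw [f_of_classQ hw]
    refine h0.mono_left ?_
    rw [← nhdsWithin_Ioc_eq_nhdsGT (zero_lt_one' ℝ)]
    exact nhdsWithin_mono _ Ioc_subset_Icc_self
  · filter_upwards [self_mem_nhdsWithin] with r hr using f_pos_of_classQ hw hr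

/-- By monotonicity, failure to diverge means `f_η` is bounded near `0`. Then the integrals of `1/w`
over `(η/(k+1), η)` are bounded, so `1/w` is integrable at `0`, against the definition of `P`. -/
theorem tendsto_f_of_classP (hw : w ∈ classP) (hη : 0 < η) :
    Tendsto (f w μ η) (𝓝[>] 0) atTop := by
  have hanti := strictAntiOn_f_of_classP (μ := μ) hw hη
  by_contra hcon
  have hbdd : ∃ M, ∀ r ∈ Ioc 0 η, f w μ η r ≤ M := by
    by_contra! hunb
    refine hcon (tendsto_atTop.2 fun M => ?_)
    obtain ⟨r, hr, hM⟩ := hunb M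
    filter_upwards [Ioo_mem_nhdsGT hr.1] with t ht
    exact hM.le.trans (hanti ht.1 hr.1 ht.2).le
  obtain ⟨M, hM⟩ := hbdd
  obtain ⟨δ, hδ, hnot⟩ := hw.2
  have hint : IntegrableOn (fun s => (w s)⁻¹) (Ioc 0 η) := by
    have hk : ∀ k : ℕ, 0 < η / (k + 1 : ℝ) ∧ η / (k + 1 : ℝ) ≤ η := fun k =>
      ⟨by positivity, div_le_self hη.le (by simp)⟩
    refine integrableOn_Ioc_of_intervalIntegral_norm_bounded_left (l := atTop)
      (a := fun k : ℕ => η / (k + 1 : ℝ)) (I := M - μ) (b := η) (fun k => ?_) ?_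
      (.of_forall fun k => ?_)
    · exact (intervalIntegrable_inv_weight hw.1 (hk k).1 hη).1
    · simpa [div_eq_mul_inv] using (tendsto_one_div_add_atTop_nhds_zero_nat (𝕜 := ℝ)).const_mul η
    · have h := hM _ (hk k)
      rw [f_of_classP hw] at h
      rw [setIntegral_congr_fun measurableSet_Ioc (g := fun s => (w s)⁻¹) fun s hs =>
        Real.norm_of_nonneg (inv_pos.2 (hw.1.2.1 s ((hk k).1.trans hs.1))).le,
        ← intervalIntegral.integral_of_le (hk k).2]
      linarith
  apply hnot
  -- The `δ` of class `P` may exceed `η`; beyond `η` continuity of `1/w` suffices.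
  have h2 : IntegrableOn (fun s => (w s)⁻¹) (Icc η (max η δ)) :=
    ((continuousOn_inv_weight hw.1).mono fun x hx => hη.trans_le hx.1).integrableOn_Icc
  refine (hint.union h2).mono_set fun x hx => ?_
  rcases le_or_gt x η with h | h
  · exact Or.inl ⟨hx.1, h⟩
  · exact Or.inr ⟨h.le, hx.2.le.trans (le_max_right _ _)⟩

/-- Inverse function theorem: a local left inverse of `F` has derivative `d⁻¹` at `F r`, which
evaluates `H` without differentiating `phi` directly. -/
theorem H_eq_of_hasStrictDerivAt {F : ℝ → ℝ} {d r : ℝ} (hF : HasStrictDerivAt F d r) (hd : d ≠ 0)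
    (hphi : ∀ᶠ x in 𝓝 r, phi w μ η (F x) = x) : H w μ η (F r) = F r * d⁻¹ / r := by
  rw [H, (hF.to_local_left_inverse hd hphi).hasDerivAt.deriv, hphi.self_of_nhds]

/-- This is the form in which the hypothesis on `H` is used. In class `P`, `1/f_η` has derivative
`1/(w f_η²)`; in class `Q`, `f_η` has derivative `1/w`. Both give `H = w f_η/r` at the corresponding
`ρ`, and that `ρ` tends to `0+` with `r`. -/
theorem tendsto_weight_mul_f_div (hw : w ∈ classW) (hμ : 0 < μ) (hη : 0 < η)
    (hH : Tendsto (H w μ η) (𝓝[>] 0) (𝓝 0)) :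
    Tendsto (fun r => w r * f w μ η r / r) (𝓝[>] 0) (𝓝 0) := by
  rw [classW_eq] at hw
  rcases hw with hw | hw
  · have ht : Tendsto (fun r => (f w μ η r)⁻¹) (𝓝[>] 0) (𝓝[>] 0) :=
      tendsto_inv_atTop_nhdsGT_zero.comp (tendsto_f_of_classP hw hη)
    refine (hH.comp ht).congr' ?_
    filter_upwards [Ioo_mem_nhdsGT hη] with r hr
    have hwr := hw.1.2.1 r hr.1
    have hfr := f_pos_of_classP hw hμ hr.1 hr.2.le
    have hF : HasStrictDerivAt (fun r => (f w μ η r)⁻¹)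
        (-(f w μ η r ^ 2)⁻¹ * (-1 / w r)) r :=
      (hasStrictDerivAt_inv hfr.ne').comp r (hasStrictDerivAt_f_of_classP hw hη hr.1)
    rw [Function.comp_apply, H_eq_of_hasStrictDerivAt hF]
    · field_simp
    · rw [neg_div, neg_mul_neg]; positivity
    · filter_upwards [Ioo_mem_nhds hr.1 hr.2] with x hx
      simp only [phi, hw, if_true, inv_inv]
      exact ((strictAntiOn_f_of_classP hw hη).injOn.mono Ioc_subset_Ioi_self).leftInvOn_invFunOn
        ⟨hx.1, hx.2.le⟩
  · refine (hH.comp (tendsto_f_of_classQ (μ := μ) (η := η) hw)).congr' ?_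
    filter_upwards [Ioo_mem_nhdsGT hη] with r hr
    have hwr := hw.1.2.1 r hr.1
    rw [Function.comp_apply, H_eq_of_hasStrictDerivAt (hasStrictDerivAt_f_of_classQ hw hr.1)
      (by positivity)]
    · field_simp
    · filter_upwards [Ioo_mem_nhds hr.1 hr.2] with x hx
      simp only [phi, notMem_classP_of_classQ hw, if_false]
      exact ((strictMonoOn_f_of_classQ hw).injOn.mono Ioc_subset_Ioi_self).leftInvOn_invFunOn
        ⟨hx.1, hx.2.le⟩

theorem f_pos (hw : w ∈ classW) (hμ : 0 < μ) {r : ℝ} (hr : 0 < r) (hrη : r ≤ η) :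
    0 < f w μ η r := by
  rw [classW_eq] at hw
  exact hw.elim (fun h => f_pos_of_classP h hμ hr hrη) fun h => f_pos_of_classQ h hr

/-- The sign `s` lets later estimates treat both classes at once. -/
theorem exists_hasDerivAt_f (hw : w ∈ classW) (hη : 0 < η) :
    ∃ s : ℝ, |s| = 1 ∧ ∀ r, 0 < r → HasDerivAt (f w μ η) (s / w r) r := by
  rw [classW_eq] at hw
  rcases hw with hw | hw
  · exact ⟨-1, by simp, fun r hr => (hasStrictDerivAt_f_of_classP hw hη hr).hasDerivAt⟩
  · exact ⟨1, by simp, fun r hr => (hasStrictDerivAt_f_of_classQ hw hr).hasDerivAt⟩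

theorem integral_inv_weight_eq (hw : w ∈ classW) {s : ℝ} (hs : |s| = 1)
    (hf : ∀ r, 0 < r → HasDerivAt (f w μ η) (s / w r) r) {a b : ℝ} (ha : 0 < a) (hb : 0 < b) :
    ∫ r in a..b, (w r)⁻¹ = s * (f w μ η b - f w μ η a) := by
  have hss : s * s = 1 := by rw [← abs_mul_abs_self, hs, one_mul]
  have h := intervalIntegral.integral_eq_sub_of_hasDerivAt (a := a) (b := b)
    (f := fun r => s * f w μ η r) (f' := fun r => (w r)⁻¹)
    (fun r hr => by
      have := (hf r ((lt_min ha hb).trans_le hr.1)).const_mul s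
      rwa [← mul_div_assoc, hss, one_div] at this)
    (intervalIntegrable_inv_weight hw ha hb)
  rw [h]; ring

/-- Close to the origin there are nested dyadic shells, described by the values of `f_η`. -/
theorem exists_shell (hw : w ∈ classW) (hη : 0 < η) (hμ : 0 < μ) {r₀ : ℝ}
    (hr₀ : 0 < r₀) (hr₀η : r₀ ≤ η) :
    ∃ l a a₁ a₂ b₂ b₁ b : ℝ, 0 < l ∧ 0 < a ∧ a < a₁ ∧ a₁ < a₂ ∧ a₂ < b₂ ∧ b₂ < b₁ ∧ b₁ < b ∧
      b < r₀ ∧ (∀ r ∈ Icc a b, f w μ η r ∈ Icc (l / 4) (4 * l)) ∧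
      (∀ r, 0 < r → r ∉ Icc a₁ b₁ → f w μ η r ∉ Ioo (l / 2) (5 / 2 * l)) ∧
      (∀ r ∈ Icc a₂ b₂, f w μ η r ∈ Icc l (2 * l)) ∧
      ∫ r in a..b, (w r)⁻¹ = 15 / 4 * l ∧ ∫ r in a₂..b₂, (w r)⁻¹ = l := by
  have hf0 := f_pos (μ := μ) hw hμ hr₀ hr₀η
  rw [classW_eq] at hw
  rcases hw with hw | hw
  · have hd : ∀ r, 0 < r → HasDerivAt (f w μ η) (-1 / w r) r := fun r hr =>
      (hasStrictDerivAt_f_of_classP hw hη hr).hasDerivAt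
    have hm := strictAntiOn_f_of_classP (μ := μ) hw hη
    have hex : ∀ c, f w μ η r₀ < c → ∃ r, 0 < r ∧ r < r₀ ∧ f w μ η r = c := by
      intro c hc
      obtain ⟨x, hx, hx0⟩ := (((tendsto_f_of_classP hw hη).eventually_ge_atTop c).and
        (Ioo_mem_nhdsGT hr₀)).exists
      obtain ⟨r, hr, rfl⟩ := intermediate_value_Icc' hx0.2.le (f := f w μ η)
        (fun y hy => (hd y (hx0.1.trans_le hy.1)).continuousAt.continuousWithinAt) ⟨hc.le, hx⟩
      refine ⟨r, hx0.1.trans_le hr.1, lt_of_le_of_ne hr.2 ?_, rfl⟩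
      rintro rfl
      exact hc.ne rfl
    -- The lowest level needed, `l/4 = 2 f_η(r₀)`, exceeds `f_η(r₀)`. As `f_η` decreases, all levels
    -- are attained inside `(0, r₀)`.
    set l := 8 * f w μ η r₀ with hl
    have hl0 : 0 < l := by positivity
    obtain ⟨b, hb, hbr, hfb⟩ := hex (l / 4) (by linarith)
    obtain ⟨b₁, hb₁, -, hfb₁⟩ := hex (l / 2) (by linarith)
    obtain ⟨b₂, hb₂, -, hfb₂⟩ := hex l (by linarith)
    obtain ⟨a₂, ha₂, -, hfa₂⟩ := hex (2 * l) (by linarith)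
    obtain ⟨a₁, ha₁, -, hfa₁⟩ := hex (5 / 2 * l) (by linarith)
    obtain ⟨a, ha, -, hfa⟩ := hex (4 * l) (by linarith)
    refine ⟨l, a, a₁, a₂, b₂, b₁, b, hl0, ha, ?_, ?_, ?_, ?_, ?_, hbr, ?_, ?_, ?_, ?_, ?_⟩
    · rw [← hm.lt_iff_gt ha₁ ha]; linarith
    · rw [← hm.lt_iff_gt ha₂ ha₁]; linarith
    · rw [← hm.lt_iff_gt hb₂ ha₂]; linarith
    · rw [← hm.lt_iff_gt hb₁ hb₂]; linarith
    · rw [← hm.lt_iff_gt hb hb₁]; linarith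
    · intro r hr
      have hr0 : 0 < r := ha.trans_le hr.1
      exact ⟨hfb ▸ (hm.le_iff_ge hb hr0).2 hr.2, hfa ▸ (hm.le_iff_ge hr0 ha).2 hr.1⟩
    · intro r hr0 hr hfr
      rw [← hfb₁, ← hfa₁] at hfr
      exact hr ⟨((hm.lt_iff_gt hr0 ha₁).1 hfr.2).le, ((hm.lt_iff_gt hb₁ hr0).1 hfr.1).le⟩
    · intro r hr
      have hr0 : 0 < r := ha₂.trans_le hr.1
      exact ⟨hfb₂ ▸ (hm.le_iff_ge hb₂ hr0).2 hr.2, hfa₂ ▸ (hm.le_iff_ge hr0 ha₂).2 hr.1⟩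
    · rw [integral_inv_weight_eq hw.1 (by simp) hd ha hb, hfa, hfb]; ring
    · rw [integral_inv_weight_eq hw.1 (by simp) hd ha₂ hb₂, hfa₂, hfb₂]; ring
  · have hd : ∀ r, 0 < r → HasDerivAt (f w μ η) (1 / w r) r := fun r hr =>
      (hasStrictDerivAt_f_of_classQ hw hr).hasDerivAt
    have hm := strictMonoOn_f_of_classQ (μ := μ) (η := η) hw
    have hex : ∀ c, 0 < c → c < f w μ η r₀ → ∃ r, 0 < r ∧ r < r₀ ∧ f w μ η r = c := by
      intro c hc0 hc
      obtain ⟨x, hx, hx0⟩ := ((((tendsto_f_of_classQ (μ := μ) (η := η) hw).mono_right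
        nhdsWithin_le_nhds).eventually_le_const hc0).and (Ioo_mem_nhdsGT hr₀)).exists
      obtain ⟨r, hr, rfl⟩ := intermediate_value_Icc hx0.2.le (f := f w μ η)
        (fun y hy => (hd y (hx0.1.trans_le hy.1)).continuousAt.continuousWithinAt) ⟨hx, hc.le⟩
      refine ⟨r, hx0.1.trans_le hr.1, lt_of_le_of_ne hr.2 ?_, rfl⟩
      rintro rfl
      exact hc.ne rfl
    -- Now `f_η` increases, and the highest level `4l` is half of `f_η(r₀)`.
    set l := f w μ η r₀ / 8 with hl
    have hl0 : 0 < l := by positivity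
    obtain ⟨a, ha, -, hfa⟩ := hex (l / 4) (by linarith) (by linarith)
    obtain ⟨a₁, ha₁, -, hfa₁⟩ := hex (l / 2) (by linarith) (by linarith)
    obtain ⟨a₂, ha₂, -, hfa₂⟩ := hex l (by linarith) (by linarith)
    obtain ⟨b₂, hb₂, -, hfb₂⟩ := hex (2 * l) (by linarith) (by linarith)
    obtain ⟨b₁, hb₁, -, hfb₁⟩ := hex (5 / 2 * l) (by linarith) (by linarith)
    obtain ⟨b, hb, hbr, hfb⟩ := hex (4 * l) (by linarith) (by linarith)
    refine ⟨l, a, a₁, a₂, b₂, b₁, b, hl0, ha, ?_, ?_, ?_, ?_, ?_, hbr, ?_, ?_, ?_, ?_, ?_⟩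
    · rw [← hm.lt_iff_lt ha ha₁]; linarith
    · rw [← hm.lt_iff_lt ha₁ ha₂]; linarith
    · rw [← hm.lt_iff_lt ha₂ hb₂]; linarith
    · rw [← hm.lt_iff_lt hb₂ hb₁]; linarith
    · rw [← hm.lt_iff_lt hb₁ hb]; linarith
    · intro r hr
      have hr0 : 0 < r := ha.trans_le hr.1
      exact ⟨hfa ▸ (hm.le_iff_le ha hr0).2 hr.1, hfb ▸ (hm.le_iff_le hr0 hb).2 hr.2⟩
    · intro r hr0 hr hfr
      rw [← hfb₁, ← hfa₁] at hfr
      exact hr ⟨((hm.lt_iff_lt ha₁ hr0).1 hfr.1).le, ((hm.lt_iff_lt hr0 hb₁).1 hfr.2).le⟩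
    · intro r hr
      have hr0 : 0 < r := ha₂.trans_le hr.1
      exact ⟨hfa₂ ▸ (hm.le_iff_le ha₂ hr0).2 hr.1, hfb₂ ▸ (hm.le_iff_le hr0 hb₂).2 hr.2⟩
    · rw [integral_inv_weight_eq hw.1 (by simp) hd ha hb, hfa, hfb]; ring
    · rw [integral_inv_weight_eq hw.1 (by simp) hd ha₂ hb₂, hfa₂, hfb₂]; ring

end Weights

/-! ### Smooth radial cutoffs with derivative of order `1/(l w)`. -/

section RadialProfile

variable {w : ℝ → ℝ} {μ η : ℝ}

theorem contDiffOn_f (hw : w ∈ classW) (hη : 0 < η) : ContDiffOn ℝ 1 (f w μ η) (Ioi 0) := by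
  obtain ⟨s, -, hs⟩ := exists_hasDerivAt_f (μ := μ) hw hη
  rw [← zero_add (1 : WithTop ℕ∞), contDiffOn_succ_iff_deriv_of_isOpen isOpen_Ioi]
  refine ⟨fun r hr => (hs r hr).differentiableAt.differentiableWithinAt, by simp, ?_⟩
  rw [contDiffOn_zero]
  refine ((continuousOn_const (c := s)).mul (continuousOn_inv_weight hw)).congr fun r hr => ?_
  exact (hs r hr).deriv.trans (div_eq_mul_inv _ _)

/-- Smooth radial cutoffs adapted to the shells of `exists_shell`, with the natural bound on the
derivative. -/
theorem exists_radial_profile : ∃ M : ℝ, 0 < M ∧ ∀ {w : ℝ → ℝ} {μ η r₀ : ℝ}, w ∈ classW →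
    0 < η → 0 < μ → 0 < r₀ → r₀ ≤ η →
    ∃ (l a a₂ b₂ b : ℝ) (k : ℝ → ℝ), 0 < l ∧ 0 < a ∧ a < a₂ ∧ a₂ < b₂ ∧ b₂ < b ∧ b < r₀ ∧
      (∀ r ∈ Icc a b, f w μ η r ∈ Icc (l / 4) (4 * l)) ∧
      (∀ r ∈ Icc a₂ b₂, f w μ η r ∈ Icc l (2 * l)) ∧
      ∫ r in a..b, (w r)⁻¹ = 15 / 4 * l ∧ ∫ r in a₂..b₂, (w r)⁻¹ = l ∧
      ContDiff ℝ ∞ k ∧ (∀ r ∉ Icc a b, k r = 0) ∧ (∀ r, |k r| ≤ 2) ∧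
      (∀ r ∈ Icc a b, |deriv k r| ≤ 2 * M / (l * w r)) ∧ ∀ r ∈ Icc a₂ b₂, 1 / 2 ≤ k r := by
  -- Equal to `1` on `[1, 2]` and supported in `[1/2, 5/2]`, matching the levels of `exists_shell`
  -- after division by `l`.
  let G : ContDiffBump (3 / 2 : ℝ) := ⟨1 / 2, 1, by norm_num, by norm_num⟩
  have hGsm : ContDiff ℝ 1 G := G.contDiff
  obtain ⟨M, hM⟩ := G.hasCompactSupport.deriv.exists_bound_of_continuous
    (hGsm.continuous_deriv le_rfl)
  refine ⟨max M 1, by positivity, fun {w μ η r₀} hw hη hμ hr₀ hr₀η => ?_⟩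
  obtain ⟨l, a, a₁, a₂, b₂, b₁, b, hl, ha, haa₁, ha₁₂, hab₂, hb₂₁, hb₁b, hbr, hfab, hfout, hfin,
    hint, hint₂⟩ := exists_shell hw hη hμ hr₀ hr₀η
  obtain ⟨s, hs, hsd⟩ := exists_hasDerivAt_f (μ := μ) hw hη
  -- For `r > 0` the composition already vanishes off `[a₁, b₁]`; the indicator only discards `r ≤
  -- 0`.
  set k₀ : ℝ → ℝ := (Icc a₁ b₁).indicator fun r => G (f w μ η r / l) with hk₀
  have heq : ∀ r, 0 < r → k₀ =ᶠ[𝓝 r] fun r => G (f w μ η r / l) := by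
    intro r hr
    filter_upwards [Ioi_mem_nhds hr] with y hy
    by_cases hyI : y ∈ Icc a₁ b₁
    · rw [hk₀, indicator_of_mem hyI]
    · rw [hk₀, indicator_of_notMem hyI]
      by_contra hne
      have hy2 : f w μ η y / l ∈ Function.support G := fun h => hne h.symm
      rw [G.support_eq, Metric.mem_ball, Real.dist_eq, abs_lt] at hy2
      have hy3 : -1 < f w μ η y / l - 3 / 2 ∧ f w μ η y / l - 3 / 2 < 1 := hy2
      refine hfout y hy hyI ⟨?_, ?_⟩
      · have : 1 / 2 < f w μ η y / l := by linarith [hy3.1]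
        rw [lt_div_iff₀ hl] at this
        linarith
      · have : f w μ η y / l < 5 / 2 := by linarith [hy3.2]
        rwa [div_lt_iff₀ hl] at this
  have hk₀sm : ContDiff ℝ 1 k₀ := by
    refine contDiff_iff_contDiffAt.2 fun r => ?_
    rcases lt_or_ge 0 r with hr | hr
    · exact (hGsm.contDiffAt.comp r (((contDiffOn_f hw hη).contDiffAt (Ioi_mem_nhds hr)).div_const
        l)).congr_of_eventuallyEq (heq r hr)
    · refine contDiffAt_const (c := (0 : ℝ)) |>.congr_of_eventuallyEq ?_
      filter_upwards [Iio_mem_nhds (hr.trans_lt (ha.trans haa₁))] with y hy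
      exact indicator_of_notMem (fun h => (mem_Iio.1 hy).not_ge h.1) _
  have hk₀d : ∀ r, 0 < r → |deriv k₀ r| ≤ max M 1 / (l * w r) := by
    intro r hr
    have hwr := hw.2.1 r hr
    have hd : HasDerivAt k₀ (deriv G (f w μ η r / l) * (s / w r / l)) r :=
      (((hGsm.differentiable one_ne_zero _).hasDerivAt).comp r
        ((hsd r hr).div_const l)).congr_of_eventuallyEq (heq r hr)
    rw [hd.deriv, abs_mul, abs_div, abs_div, hs, abs_of_pos hwr, abs_of_pos hl]
    calc _ ≤ max M 1 * (1 / w r / l) := by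
          gcongr
          exact (hM _).trans (le_max_left _ _)
      _ = _ := by field_simp
  -- `k₀` is only `C¹`, as `w` is. A positive lower bound for the derivative bound on `[a, b]` lets
  -- the smoothing error be absorbed by doubling the constant.
  obtain ⟨ε, hε, hε'⟩ : ∃ ε : ℝ, 0 < ε ∧ ∀ r ∈ Icc a b, ε ≤ max M 1 / (l * w r) := by
    have hc : ContinuousOn (fun r => max M 1 / (l * w r)) (Icc a b) :=
      continuousOn_const.div (continuousOn_const.mul (hw.1.continuousOn.mono
        fun r hr => ha.trans_le hr.1)) fun r hr => (mul_pos hl (hw.2.1 r (ha.trans_le hr.1))).ne'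
    obtain ⟨z, hz, hmin⟩ := isCompact_Icc.exists_isMinOn
      (nonempty_Icc.2 (by linarith : a ≤ b)) hc
    exact ⟨_, div_pos (by positivity) (mul_pos hl (hw.2.1 z (ha.trans_le hz.1))),
      fun r hr => hmin hr⟩
  obtain ⟨k, hk, hksupp, hk1, hk2⟩ := exists_contDiff_approx_deriv hk₀sm
    (fun x hx => indicator_of_notMem hx _) (lt_min hε (one_half_pos (α := ℝ)))
    (lt_min (sub_pos.2 haa₁) (sub_pos.2 hb₁b))
  refine ⟨l, a, a₂, b₂, b, k, hl, ha, haa₁.trans ha₁₂, hab₂, hb₂₁.trans hb₁b, hbr, hfab, hfin,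
    hint, hint₂, hk, fun r hr => hksupp r fun h => hr ⟨?_, ?_⟩, fun r => ?_, fun r hr => ?_,
    fun r hr => ?_⟩
  · linarith [h.1, min_le_left (a₁ - a) (b - b₁)]
  · linarith [h.2, min_le_right (a₁ - a) (b - b₁)]
  · have h0 : |k₀ r| ≤ 1 := by
      rw [hk₀, indicator]
      split_ifs
      · rw [abs_of_nonneg G.nonneg]; exact G.le_one
      · simp
    have := abs_add_le (k r - k₀ r) (k₀ r)
    rw [sub_add_cancel] at this
    linarith [hk1 r, min_le_right ε (1 / 2 : ℝ)]
  · have := abs_add_le (deriv k r - deriv k₀ r) (deriv k₀ r)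
    rw [sub_add_cancel] at this
    have h3 := hk₀d r (ha.trans_le hr.1)
    have h4 := hε' r hr
    have h5 : 2 * max M 1 / (l * w r) = max M 1 / (l * w r) + max M 1 / (l * w r) := by ring
    linarith [hk2 r, min_le_left ε (1 / 2 : ℝ)]
  · have h1 : k₀ r = 1 := by
      have hmem : r ∈ Icc a₁ b₁ := ⟨ha₁₂.le.trans hr.1, hr.2.trans hb₂₁.le⟩
      rw [hk₀, indicator_of_mem hmem]
      apply G.one_of_mem_closedBall
      rw [Metric.mem_closedBall, Real.dist_eq, abs_le]
      have := hfin r hr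
      have h6 : 1 ≤ f w μ η r / l := by rw [le_div_iff₀ hl]; linarith [this.1]
      have h7 : f w μ η r / l ≤ 2 := by rw [div_le_iff₀ hl]; exact this.2
      show -(1 / 2) ≤ _ ∧ _ ≤ (1 / 2 : ℝ)
      constructor <;> linarith
    have := (abs_le.1 (hk1 r)).1
    linarith [min_le_right ε (1 / 2 : ℝ)]

end RadialProfile

/-! ### Spherical caps and integration over sectors. -/

section PolarCoordinates

variable {n : ℕ}

/-- The surface measure of the unit sphere, as a measure on the ambient space. -/
def sphereMeasure (n : ℕ) : Measure (EuclideanSpace ℝ (Fin n)) :=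
  (volume : Measure (EuclideanSpace ℝ (Fin n))).toSphere.map Subtype.val

instance : IsFiniteMeasure (sphereMeasure n) := by
  unfold sphereMeasure; infer_instance

theorem sphereMeasure_apply {T : Set (EuclideanSpace ℝ (Fin n))} (hT : MeasurableSet T) :
    sphereMeasure n T =
      (volume : Measure (EuclideanSpace ℝ (Fin n))).toSphere (Subtype.val ⁻¹' T) :=
  Measure.map_apply measurable_subtype_coe hT

/-- The cone over a point lies in a subspace of dimension at most one, which is Lebesgue null
because `n > 1`. -/
theorem sphereMeasure_singleton (hn : 1 < n) (e : EuclideanSpace ℝ (Fin n)) :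
    sphereMeasure n {e} = 0 := by
  rw [sphereMeasure_apply (measurableSet_singleton e),
    Measure.toSphere_apply' _ (measurable_subtype_coe (measurableSet_singleton e))]
  have hle : (volume : Measure (EuclideanSpace ℝ (Fin n)))
      (Submodule.span ℝ {e} : Submodule ℝ (EuclideanSpace ℝ (Fin n))) = 0 := by
    apply Measure.addHaar_submodule
    intro h
    have h1 := finrank_span_le_card (R := ℝ) ({e} : Set (EuclideanSpace ℝ (Fin n)))
    rw [toFinset_singleton, Finset.card_singleton] at h1
    rw [h, finrank_top, finrank_euclideanSpace_fin] at h1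
    omega
  rw [measure_mono_null ?_ hle, mul_zero]
  rintro _ ⟨c, -, _, ⟨y, hy, rfl⟩, rfl⟩
  have hy' : (y : EuclideanSpace ℝ (Fin n)) = e := hy
  simp only [hy']
  exact Submodule.smul_mem _ _ (Submodule.mem_span_singleton_self e)

theorem sphereMeasure_closedBall_pos {e : EuclideanSpace ℝ (Fin n)} (he : ‖e‖ = 1) {r : ℝ}
    (hr : 0 < r) : 0 < sphereMeasure n (Metric.closedBall e r) := by
  rw [sphereMeasure_apply Metric.isClosed_closedBall.measurableSet]
  have hopen : IsOpen ((Subtype.val : Metric.sphere (0 : EuclideanSpace ℝ (Fin n)) 1 → _) ⁻¹'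
    Metric.ball e r) := Metric.isOpen_ball.preimage continuous_subtype_val
  refine (hopen.measure_pos _ ⟨⟨e, by simpa using he⟩, by simpa using hr⟩).trans_le
    (measure_mono (preimage_mono Metric.ball_subset_closedBall))

/-- Continuity from above. At radius `0` it yields caps of small measure, at positive radius the
doubling of a slightly larger cap. -/
theorem tendsto_sphereMeasure_closedBall (e : EuclideanSpace ℝ (Fin n)) (r : ℝ) :
    Tendsto (fun s => sphereMeasure n (Metric.closedBall e s)) (𝓝[>] r)
      (𝓝 (sphereMeasure n (Metric.closedBall e r))) := by
  have h := tendsto_measure_biInter_gt (μ := sphereMeasure n) (s := fun s => Metric.closedBall e s)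
    (a := r) (fun s _ => Metric.isClosed_closedBall.measurableSet.nullMeasurableSet)
    (fun i j _ hij => Metric.closedBall_subset_closedBall hij) ⟨r + 1, by simp, measure_ne_top _ _⟩
  convert h using 3
  congr 1
  ext x
  simp only [Metric.mem_closedBall, mem_iInter]
  exact ⟨fun hx s hs => hx.trans hs.le, fun hx => le_of_forall_gt_imp_ge_of_dense hx⟩

/-- There are caps of the sphere of arbitrarily small positive measure, each contained in a strictly
larger concentric cap of at most twice the measure. -/
theorem exists_small_cap (hn : 1 < n) {e : EuclideanSpace ℝ (Fin n)} (he : ‖e‖ = 1) {ε : ℝ}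
    (hε : 0 < ε) : ∃ r R : ℝ, 0 < r ∧ r < R ∧
      0 < (sphereMeasure n).real (Metric.closedBall e r) ∧
      (sphereMeasure n).real (Metric.closedBall e r) < ε ∧
      (sphereMeasure n).real (Metric.closedBall e R) ≤
        2 * (sphereMeasure n).real (Metric.closedBall e r) := by
  have key : ∀ r, Tendsto (fun s => (sphereMeasure n).real (Metric.closedBall e s)) (𝓝[>] r)
      (𝓝 ((sphereMeasure n).real (Metric.closedBall e r))) := fun r =>
    (ENNReal.tendsto_toReal (measure_ne_top _ _)).comp (tendsto_sphereMeasure_closedBall e r)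
  have h0 : (sphereMeasure n).real (Metric.closedBall e 0) = 0 := by
    rw [Metric.closedBall_zero, measureReal_def, sphereMeasure_singleton hn]; rfl
  obtain ⟨r, hr, hr0⟩ := (((key 0).eventually_lt_const (by rwa [h0])).and
    self_mem_nhdsWithin).exists
  have hpos : 0 < (sphereMeasure n).real (Metric.closedBall e r) :=
    ENNReal.toReal_pos (sphereMeasure_closedBall_pos he hr0).ne' (measure_ne_top _ _)
  obtain ⟨R, hR, hrR⟩ := (((key r).eventually_lt_const
    (show _ < 2 * (sphereMeasure n).real (Metric.closedBall e r) by linarith)).and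
    self_mem_nhdsWithin).exists
  exact ⟨r, R, hr0, hrR, hpos, hr, hR.le⟩

/-- Integration in polar coordinates over a sector of an annulus. -/
theorem integral_sector (hn : 1 < n) {a b : ℝ} (ha : 0 < a) (hab : a ≤ b)
    {T : Set (EuclideanSpace ℝ (Fin n))} (hT : MeasurableSet T) (g : ℝ → ℝ) :
    ∫ x in {x : EuclideanSpace ℝ (Fin n) | ‖x‖ ∈ Icc a b ∧ ‖x‖⁻¹ • x ∈ T},
      g ‖x‖ * ‖x‖ ^ (1 - (n : ℝ)) = (sphereMeasure n).real T * ∫ r in a..b, g r := by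
  have : Nonempty (Fin n) := ⟨⟨0, by omega⟩⟩
  set μ := (volume : Measure (EuclideanSpace ℝ (Fin n)))
  have hS : MeasurableSet {x : EuclideanSpace ℝ (Fin n) | ‖x‖ ∈ Icc a b ∧ ‖x‖⁻¹ • x ∈ T} :=
    (measurable_norm measurableSet_Icc).inter ((by fun_prop : Measurable
      fun x : EuclideanSpace ℝ (Fin n) => ‖x‖⁻¹ • x) hT)
  rw [← integral_indicator hS]
  set G : ℝ → ℝ := (Icc a b).indicator fun r => g r * r ^ (1 - (n : ℝ)) with hG
  set I : Metric.sphere (0 : EuclideanSpace ℝ (Fin n)) 1 → ℝ :=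
    fun y => T.indicator (fun _ => (1 : ℝ)) y with hI
  have hI' : I = (Subtype.val ⁻¹' T).indicator fun _ => (1 : ℝ) := rfl
  have hpt : ∀ x : EuclideanSpace ℝ (Fin n), {x : EuclideanSpace ℝ (Fin n) | ‖x‖ ∈ Icc a b ∧
      ‖x‖⁻¹ • x ∈ T}.indicator (fun x => g ‖x‖ * ‖x‖ ^ (1 - (n : ℝ))) x =
      T.indicator (fun _ => (1 : ℝ)) (‖x‖⁻¹ • x) * G ‖x‖ := by
    intro x
    by_cases h1 : ‖x‖ ∈ Icc a b <;> by_cases h2 : ‖x‖⁻¹ • x ∈ T <;>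
      simp only [hG, indicator, mem_ofPred_eq, h1, h2, if_true, if_false, and_true, and_false,
        and_self, one_mul, zero_mul, mul_zero]
  simp_rw [hpt]
  calc ∫ x, T.indicator (fun _ => (1 : ℝ)) (‖x‖⁻¹ • x) * G ‖x‖ ∂μ
      = ∫ x : ({(0)}ᶜ : Set (EuclideanSpace ℝ (Fin n))),
          T.indicator (fun _ => (1 : ℝ)) (‖x.1‖⁻¹ • x.1) * G ‖x.1‖ ∂(μ.comap (↑)) := by
        rw [integral_subtype_comap (measurableSet_singleton _).compl
          fun x => T.indicator (fun _ => (1 : ℝ)) (‖x‖⁻¹ • x) * G ‖x‖,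
          restrict_compl_singleton]
    _ = ∫ z, I z.1 * G z.2 ∂μ.toSphere.prod
          (.volumeIoiPow (Module.finrank ℝ (EuclideanSpace ℝ (Fin n)) - 1)) := by
        rw [← μ.measurePreserving_homeomorphUnitSphereProd.integral_comp
          (Homeomorph.measurableEmbedding _)]
        refine integral_congr_ae (.of_forall fun x => ?_)
        simp only [hI, homeomorphUnitSphereProd_apply_fst_coe,
          homeomorphUnitSphereProd_apply_snd_coe]
    _ = (∫ y, I y ∂μ.toSphere) * ∫ r : Ioi (0 : ℝ), G r
          ∂(.volumeIoiPow (Module.finrank ℝ (EuclideanSpace ℝ (Fin n)) - 1)) :=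
        integral_prod_mul (μ := μ.toSphere) I fun r : Ioi (0 : ℝ) => G r
    _ = _ := by
        congr 1
        · rw [hI', integral_indicator_const _ (measurable_subtype_coe hT), smul_eq_mul, mul_one,
            measureReal_def, measureReal_def, sphereMeasure_apply hT]
        · simp only [Measure.volumeIoiPow, ENNReal.ofReal]
          rw [integral_withDensity_eq_integral_smul
            (measurable_subtype_coe.pow_const _).real_toNNReal,
            integral_subtype_comap measurableSet_Ioi fun r => Real.toNNReal
              (r ^ (Module.finrank ℝ (EuclideanSpace ℝ (Fin n)) - 1)) • G r,
            finrank_euclideanSpace_fin, intervalIntegral.integral_of_le hab,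
            ← integral_Icc_eq_integral_Ioc, ← integral_indicator measurableSet_Icc,
            ← integral_indicator measurableSet_Ioi]
          refine integral_congr_ae (.of_forall fun r => ?_)
          by_cases hr : r ∈ Icc a b
          · have hr0 : 0 < r := ha.trans_le hr.1
            simp only [hG, indicator_of_mem hr, indicator_of_mem (mem_Ioi.2 hr0), NNReal.smul_def,
              Real.coe_toNNReal _ (pow_nonneg hr0.le _), smul_eq_mul]
            -- The polar Jacobian cancels the weight.
            have : r ^ (n - 1) * r ^ (1 - (n : ℝ)) = 1 := by
              rw [← Real.rpow_natCast, ← Real.rpow_add hr0, Nat.cast_sub hn.le]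
              simp
            calc r ^ (n - 1) * (g r * r ^ (1 - (n : ℝ)))
                = g r * (r ^ (n - 1) * r ^ (1 - (n : ℝ))) := by ring
              _ = g r := by rw [this, mul_one]
          · simp [hG, hr, indicator]

end PolarCoordinates

/-! ### Products of a radial and an angular cutoff. -/

section TestFunctions

section Angular

variable {E : Type*} [NormedAddCommGroup E]

/-- Changing the length and changing the vector each cost at most `‖y - x‖/‖x‖`. This is the source
of the factor `1/|x|` in the angular derivative. -/
theorem norm_normalize_sub_le [NormedSpace ℝ E] {x : E} (hx : x ≠ 0) (y : E) :
    ‖‖y‖⁻¹ • y - ‖x‖⁻¹ • x‖ ≤ 2 / ‖x‖ * ‖y - x‖ := by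
  have hx' : 0 < ‖x‖ := norm_pos_iff.2 hx
  have h1 : ‖y‖⁻¹ • y - ‖x‖⁻¹ • x = (‖y‖⁻¹ - ‖x‖⁻¹) • y + ‖x‖⁻¹ • (y - x) := by
    rw [sub_smul, smul_sub]; abel
  have h2 : ‖(‖y‖⁻¹ - ‖x‖⁻¹) • y‖ ≤ ‖x‖⁻¹ * ‖y - x‖ := by
    rcases eq_or_ne y 0 with rfl | hy
    · rw [smul_zero, norm_zero]; positivity
    have hy' : 0 < ‖y‖ := norm_pos_iff.2 hy
    have h3 : (‖y‖⁻¹ - ‖x‖⁻¹) * ‖y‖ = -(‖x‖⁻¹ * (‖y‖ - ‖x‖)) := by field_simp; ring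
    rw [norm_smul, ← Real.norm_of_nonneg (norm_nonneg y), ← norm_mul, norm_norm, h3, norm_neg,
      norm_mul, Real.norm_of_nonneg (inv_nonneg.2 hx'.le)]
    gcongr
    exact abs_norm_sub_norm_le y x
  rw [h1]
  refine (norm_add_le _ _).trans ?_
  rw [norm_smul (‖x‖⁻¹), norm_inv, norm_norm]
  calc _ ≤ ‖x‖⁻¹ * ‖y - x‖ + ‖x‖⁻¹ * ‖y - x‖ := by gcongr
    _ = _ := by ring

variable [InnerProductSpace ℝ E] {ψ : E → ℝ} {k : ℝ → ℝ} {a b : ℝ} {L : ℝ≥0}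

theorem contDiffAt_angular (hψ : ContDiff ℝ ∞ ψ) {x : E} (hx : x ≠ 0) :
    ContDiffAt ℝ ∞ (fun y => ψ (‖y‖⁻¹ • y)) x :=
  hψ.contDiffAt.comp x (((contDiffAt_norm ℝ hx).inv (norm_ne_zero_iff.2 hx)).smul contDiffAt_id)

theorem norm_fderiv_angular_le (hL : LipschitzWith L ψ) {x : E} (hx : x ≠ 0) :
    ‖fderiv ℝ (fun y => ψ (‖y‖⁻¹ • y)) x‖ ≤ 2 * L / ‖x‖ := by
  refine norm_fderiv_le_of_lip' ℝ (by positivity) (.of_forall fun y => ?_)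
  calc ‖ψ (‖y‖⁻¹ • y) - ψ (‖x‖⁻¹ • x)‖ ≤ L * ‖‖y‖⁻¹ • y - ‖x‖⁻¹ • x‖ := hL.norm_sub_le _ _
    _ ≤ L * (2 / ‖x‖ * ‖y - x‖) := by gcongr; exact norm_normalize_sub_le hx y
    _ = _ := by ring

theorem contDiff_radial_mul_angular (hψ : ContDiff ℝ ∞ ψ) (hk : ContDiff ℝ ∞ k)
    (hsupp : ∀ r ∉ Icc a b, k r = 0) (ha : 0 < a) :
    ContDiff ℝ ∞ (fun x : E => k ‖x‖ * ψ (‖x‖⁻¹ • x)) := by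
  refine contDiff_iff_contDiffAt.2 fun x => ?_
  rcases eq_or_ne x 0 with rfl | hx
  · refine contDiffAt_const (c := (0 : ℝ)) |>.congr_of_eventuallyEq ?_
    filter_upwards [Metric.ball_mem_nhds (0 : E) ha] with y hy
    rw [hsupp _ fun h => (mem_ball_zero_iff.1 hy).not_ge h.1, zero_mul]
  · exact (hk.contDiffAt.comp x (contDiffAt_norm ℝ hx)).mul (contDiffAt_angular hψ hx)

theorem tsupport_radial_mul_angular_subset (hsupp : ∀ r ∉ Icc a b, k r = 0) :
    tsupport (fun x : E => k ‖x‖ * ψ (‖x‖⁻¹ • x)) ⊆ {x | ‖x‖ ∈ Icc a b} := by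
  refine closure_minimal (fun x hx => ?_) (isClosed_Icc.preimage continuous_norm)
  by_contra h
  exact hx (by simp only [hsupp _ h, zero_mul])

theorem isCompact_shell [FiniteDimensional ℝ E] (a b : ℝ) :
    IsCompact {x : E | ‖x‖ ∈ Icc a b} :=
  (isCompact_closedBall (0 : E) b).of_isClosed_subset (isClosed_Icc.preimage continuous_norm)
    fun _ hx => mem_closedBall_zero_iff.2 hx.2

theorem norm_gradient_radial_mul_angular_le [CompleteSpace E] (hψ : ContDiff ℝ ∞ ψ)
    (hL : LipschitzWith L ψ) (hk : ContDiff ℝ ∞ k) {x : E} (hx : x ≠ 0) :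
    ‖gradient (fun x : E => k ‖x‖ * ψ (‖x‖⁻¹ • x)) x‖ ≤
      |deriv k ‖x‖| * |ψ (‖x‖⁻¹ • x)| + |k ‖x‖| * (2 * L / ‖x‖) := by
  have h1 : HasFDerivAt (fun y : E => k ‖y‖) (deriv k ‖x‖ • fderiv ℝ (fun y : E => ‖y‖) x) x :=
    ((hk.differentiable (by simp)) ‖x‖).hasDerivAt.comp_hasFDerivAt x
      ((contDiffAt_norm ℝ hx).differentiableAt one_ne_zero).hasFDerivAt
  have h2 := ((contDiffAt_angular hψ hx).differentiableAt (by simp)).hasFDerivAt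
  have h3 : ‖fderiv ℝ (fun y : E => ‖y‖) x‖ ≤ 1 := by
    simpa using norm_fderiv_le_of_lipschitz ℝ (lipschitzWith_one_norm (E := E)) (x₀ := x)
  rw [gradient, LinearIsometryEquiv.norm_map, (h1.fun_mul h2).fderiv, add_comm]
  refine (norm_add_le _ _).trans ?_
  rw [norm_smul, norm_smul, norm_smul, Real.norm_eq_abs, Real.norm_eq_abs, Real.norm_eq_abs]
  have h4 := norm_fderiv_angular_le hL hx
  calc _ ≤ |ψ (‖x‖⁻¹ • x)| * (|deriv k ‖x‖| * 1) + |k ‖x‖| * (2 * L / ‖x‖) := by gcongr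
    _ = _ := by ring

theorem gradient_radial_mul_angular_eq_zero [CompleteSpace E] (hsupp : ∀ r ∉ Icc a b, k r = 0)
    {x : E} (hx : ‖x‖ ∉ Icc a b) :
    gradient (fun x : E => k ‖x‖ * ψ (‖x‖⁻¹ • x)) x = 0 := by
  have h : (fun x : E => k ‖x‖ * ψ (‖x‖⁻¹ • x)) =ᶠ[𝓝 x] fun _ => (0 : ℝ) := by
    filter_upwards [(isClosed_Icc.preimage continuous_norm).isOpen_compl.mem_nhds hx] with y hy
    rw [hsupp _ hy, zero_mul]
  rw [gradient, h.fderiv_eq]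
  simp

end Angular

theorem isTestFunction_radial_mul_angular {n : ℕ} {η a b : ℝ} {k : ℝ → ℝ}
    {ψ : EuclideanSpace ℝ (Fin n) → ℝ} (hψ : ContDiff ℝ ∞ ψ) (hk : ContDiff ℝ ∞ k)
    (hsupp : ∀ r ∉ Icc a b, k r = 0) (ha : 0 < a) (hb : b < η) :
    IsTestFunction n η (fun x => k ‖x‖ * ψ (‖x‖⁻¹ • x)) := by
  have hs := tsupport_radial_mul_angular_subset (ψ := ψ) hsupp
  refine ⟨contDiff_radial_mul_angular hψ hk hsupp ha,
    (isCompact_shell a b).of_isClosed_subset (isClosed_tsupport _) hs, fun x hx => ?_⟩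
  have hx' := hs hx
  refine ⟨mem_ball_zero_iff.2 (hx'.2.trans_lt hb), ?_⟩
  rintro rfl
  exact (ha.trans_le hx'.1).ne' norm_zero

end TestFunctions

/-! ### Energy bounds and the resulting inequality between cap measures. -/

section CapInequality

variable {n : ℕ} {w : ℝ → ℝ} {μ η p q : ℝ}

theorem measurableSet_sector (a b : ℝ) {T : Set (EuclideanSpace ℝ (Fin n))}
    (hT : MeasurableSet T) :
    MeasurableSet {x : EuclideanSpace ℝ (Fin n) | ‖x‖ ∈ Icc a b ∧ ‖x‖⁻¹ • x ∈ T} :=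
  (measurable_norm measurableSet_Icc).inter ((by fun_prop : Measurable
    fun x : EuclideanSpace ℝ (Fin n) => ‖x‖⁻¹ • x) hT)

theorem continuousOn_comp_norm {g : ℝ → ℝ} (hg : ContinuousOn g (Ioi 0)) {a b : ℝ} (ha : 0 < a) :
    ContinuousOn (fun x : EuclideanSpace ℝ (Fin n) => g ‖x‖) {x | ‖x‖ ∈ Icc a b} :=
  hg.comp continuous_norm.continuousOn fun _ hx => ha.trans_le hx.1

theorem continuousOn_norm_rpow (t : ℝ) {a b : ℝ} (ha : 0 < a) :
    ContinuousOn (fun x : EuclideanSpace ℝ (Fin n) => ‖x‖ ^ t) {x | ‖x‖ ∈ Icc a b} :=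
  continuous_norm.continuousOn.rpow_const fun _ hx => Or.inl (ha.trans_le hx.1).ne'

theorem integrableOn_inv_weight_mul (hw : w ∈ classW) {a b : ℝ} (ha : 0 < a) :
    IntegrableOn (fun x : EuclideanSpace ℝ (Fin n) => (w ‖x‖)⁻¹ * ‖x‖ ^ (1 - (n : ℝ)))
      {x | ‖x‖ ∈ Icc a b} :=
  ((continuousOn_comp_norm (continuousOn_inv_weight hw) ha).mul
    (continuousOn_norm_rpow _ ha)).integrableOn_compact (isCompact_shell a b)

/-- Upper bound for the gradient energy of a function supported in a shell, from a pointwise bound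
that is better outside the cone over `T`. -/
theorem integral_gradient_le (hn : 1 < n) (hp : 1 < p) (hw : w ∈ classW) {a b l A B : ℝ}
    (ha : 0 < a) (hab : a ≤ b) (hb : b < η) (hl : 0 < l) (hA : 0 ≤ A) (hB : 0 ≤ B)
    {T : Set (EuclideanSpace ℝ (Fin n))} (hT : MeasurableSet T)
    {v : EuclideanSpace ℝ (Fin n) → EuclideanSpace ℝ (Fin n)}
    (hv0 : ∀ x, ‖x‖ ∉ Icc a b → v x = 0)
    (hvT : ∀ x, ‖x‖ ∈ Icc a b → ‖x‖⁻¹ • x ∈ T → ‖v x‖ ≤ A / (l * w ‖x‖))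
    (hv : ∀ x, ‖x‖ ∈ Icc a b → ‖x‖⁻¹ • x ∉ T → ‖v x‖ ≤ B / (l * w ‖x‖)) :
    ∫ x in Metric.ball (0 : EuclideanSpace ℝ (Fin n)) η,
        ‖v x‖ ^ p * w ‖x‖ ^ (p - 1) * ‖x‖ ^ (1 - (n : ℝ)) ≤
      l ^ (-p) * (A ^ p * (sphereMeasure n).real T + B ^ p * (sphereMeasure n).real univ) *
        ∫ r in a..b, (w r)⁻¹ := by
  set D : EuclideanSpace ℝ (Fin n) → ℝ := fun x => (w ‖x‖)⁻¹ * ‖x‖ ^ (1 - (n : ℝ)) with hD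
  set S : Set (EuclideanSpace ℝ (Fin n)) := {x | ‖x‖ ∈ Icc a b} with hS
  set K : Set (EuclideanSpace ℝ (Fin n)) := {x | ‖x‖⁻¹ • x ∈ T} with hK
  have hSm : MeasurableSet S := measurable_norm measurableSet_Icc
  have hKm : MeasurableSet K := (by fun_prop : Measurable
    fun x : EuclideanSpace ℝ (Fin n) => ‖x‖⁻¹ • x) hT
  have hDint : IntegrableOn D S := integrableOn_inv_weight_mul hw ha
  have hwpos : ∀ x ∈ S, 0 < w ‖x‖ := fun x hx => hw.2.1 _ (ha.trans_le hx.1)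
  have hbound : ∀ x ∈ S, ∀ E : ℝ, 0 ≤ E → ‖v x‖ ≤ E / (l * w ‖x‖) →
      ‖v x‖ ^ p * w ‖x‖ ^ (p - 1) * ‖x‖ ^ (1 - (n : ℝ)) ≤ l ^ (-p) * E ^ p * D x := by
    intro x hx E hE hvE
    have hwx := hwpos x hx
    have h1 : ‖v x‖ ^ p ≤ (E / (l * w ‖x‖)) ^ p :=
      Real.rpow_le_rpow (norm_nonneg _) hvE (by linarith)
    -- The weight `w^(p-1)` against `w^(-p)` leaves `1/w`, whose integral over the shell is known.
    have h2 : (E / (l * w ‖x‖)) ^ p * w ‖x‖ ^ (p - 1) = l ^ (-p) * E ^ p * (w ‖x‖)⁻¹ := by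
      rw [Real.div_rpow hE (by positivity), Real.mul_rpow hl.le hwx.le, Real.rpow_neg hl.le,
        Real.rpow_sub hwx, Real.rpow_one]
      have := (Real.rpow_pos_of_pos hwx p).ne'
      have := (Real.rpow_pos_of_pos hl p).ne'
      field_simp
    calc _ ≤ (E / (l * w ‖x‖)) ^ p * w ‖x‖ ^ (p - 1) * ‖x‖ ^ (1 - (n : ℝ)) := by gcongr
      _ = _ := by rw [h2, hD, mul_assoc]
  have hsub : S ⊆ Metric.ball 0 η := fun x hx => mem_ball_zero_iff.2 (hx.2.trans_lt hb)
  rw [setIntegral_eq_of_subset_of_forall_sdiff_eq_zero measurableSet_ball hsub fun x hx => by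
    rw [hv0 x hx.2, norm_zero, Real.zero_rpow (by linarith), zero_mul, zero_mul]]
  have hint1 : IntegrableOn (fun x => l ^ (-p) * A ^ p * K.indicator D x) S :=
    (hDint.indicator hKm).const_mul _
  have hint2 : IntegrableOn (fun x => l ^ (-p) * B ^ p * D x) S := hDint.const_mul _
  have hle : ∫ x in S, ‖v x‖ ^ p * w ‖x‖ ^ (p - 1) * ‖x‖ ^ (1 - (n : ℝ)) ≤
      ∫ x in S, (l ^ (-p) * A ^ p * K.indicator D x + l ^ (-p) * B ^ p * D x) := by
    -- `v` need not be measurable: only the majorant has to be integrable.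
    refine integral_mono_of_nonneg ?_ (hint1.add hint2) ?_
    · filter_upwards [ae_restrict_mem hSm] with x hx
      have := hwpos x hx
      positivity
    · filter_upwards [ae_restrict_mem hSm] with x hx
      have hwx := hwpos x hx
      have hDx : 0 ≤ D x := by positivity
      by_cases hxK : x ∈ K
      · rw [indicator_of_mem hxK]
        have : 0 ≤ l ^ (-p) * B ^ p * D x := by positivity
        linarith [hbound x hx A hA (hvT x hx hxK)]
      · rw [indicator_of_notMem hxK, mul_zero, zero_add]
        exact hbound x hx B hB (hv x hx hxK)
  have hI1 : ∫ x in S, K.indicator D x = (sphereMeasure n).real T * ∫ r in a..b, (w r)⁻¹ := by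
    rw [setIntegral_indicator hKm]
    exact integral_sector hn ha hab hT fun r => (w r)⁻¹
  have hI2 : ∫ x in S, D x = (sphereMeasure n).real univ * ∫ r in a..b, (w r)⁻¹ := by
    rw [← integral_sector hn ha hab MeasurableSet.univ fun r => (w r)⁻¹]
    simp only [mem_univ, and_true, hS, hD]
  rw [integral_add hint1 hint2, integral_const_mul, integral_const_mul, hI1, hI2] at hle
  exact hle.trans_eq (by ring)

/-- Lower bound for the weighted `L^q` integral of a function supported in a shell that is at least
`1/2` on a sector. -/
theorem le_integral_rpow (hn : 1 < n) (hq : 0 < q) (hw : w ∈ classW) (hη : 0 < η) (hμ : 0 < μ)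
    {t a a₂ b₂ b l : ℝ} (ht : 0 ≤ t) (ha : 0 < a) (ha₂ : a ≤ a₂) (hab₂ : a₂ ≤ b₂) (hb₂ : b₂ ≤ b)
    (hb : b < η) (hl : 0 < l) {T : Set (EuclideanSpace ℝ (Fin n))} (hT : MeasurableSet T)
    {u : EuclideanSpace ℝ (Fin n) → ℝ} (hu : Continuous u) (hu0 : ∀ x, ‖x‖ ∉ Icc a b → u x = 0)
    (huT : ∀ x, ‖x‖ ∈ Icc a₂ b₂ → ‖x‖⁻¹ • x ∈ T → 1 / 2 ≤ u x)
    (hf : ∀ r ∈ Icc a₂ b₂, f w μ η r ≤ 2 * l) :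
    (1 / 2) ^ q / (2 * l) ^ t * ((sphereMeasure n).real T * ∫ r in a₂..b₂, (w r)⁻¹) ≤
      ∫ x in Metric.ball (0 : EuclideanSpace ℝ (Fin n)) η,
        |u x| ^ q * ‖x‖ ^ (1 - (n : ℝ)) / (w ‖x‖ * f w μ η ‖x‖ ^ t) := by
  obtain ⟨s, -, hs⟩ := exists_hasDerivAt_f (μ := μ) hw hη
  set J : EuclideanSpace ℝ (Fin n) → ℝ := fun x =>
    |u x| ^ q * ‖x‖ ^ (1 - (n : ℝ)) / (w ‖x‖ * f w μ η ‖x‖ ^ t) with hJ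
  have hJ0 : ∀ x, ‖x‖ ∉ Icc a b → J x = 0 := fun x hx => by
    simp only [hJ, hu0 x hx, abs_zero, Real.zero_rpow hq.ne', zero_mul, zero_div]
  have hfpos : ∀ x : EuclideanSpace ℝ (Fin n), ‖x‖ ∈ Icc a b → 0 < f w μ η ‖x‖ := fun x hx =>
    f_pos hw hμ (ha.trans_le hx.1) (hx.2.trans hb.le)
  have hwpos : ∀ x : EuclideanSpace ℝ (Fin n), ‖x‖ ∈ Icc a b → 0 < w ‖x‖ := fun x hx =>
    hw.2.1 _ (ha.trans_le hx.1)
  have hJcont : ContinuousOn J {x | ‖x‖ ∈ Icc a b} := by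
    refine ((hu.abs.rpow_const fun x => Or.inr hq.le).continuousOn.mul
      (continuousOn_norm_rpow _ ha)).div ((continuousOn_comp_norm hw.1.continuousOn ha).mul
        ((continuousOn_comp_norm (fun r hr =>
          (hs r hr).continuousAt.continuousWithinAt) ha).rpow_const fun x hx =>
            Or.inl (hfpos x hx).ne')) fun x hx => ?_
    exact (mul_pos (hwpos x hx) (Real.rpow_pos_of_pos (hfpos x hx) _)).ne'
  have hJint : IntegrableOn J (Metric.ball 0 η) :=
    (hJcont.integrableOn_compact (isCompact_shell a b)).of_forall_sdiff_eq_zero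
      measurableSet_ball fun x hx => hJ0 x hx.2
  have hJnn : ∀ x, 0 ≤ J x := by
    intro x
    by_cases hx : ‖x‖ ∈ Icc a b
    · have := hfpos x hx
      have := hwpos x hx
      positivity
    · exact (hJ0 x hx).ge
  set S : Set (EuclideanSpace ℝ (Fin n)) := {x | ‖x‖ ∈ Icc a₂ b₂ ∧ ‖x‖⁻¹ • x ∈ T} with hS
  have hSsub : S ⊆ Metric.ball 0 η := fun x hx =>
    mem_ball_zero_iff.2 ((hx.1.2.trans hb₂).trans_lt hb)
  have hSm : MeasurableSet S := measurableSet_sector a₂ b₂ hT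
  rw [← integral_sector hn (ha.trans_le ha₂) hab₂ hT, ← integral_const_mul]
  refine le_trans ?_ (setIntegral_mono_set hJint (.of_forall hJnn) hSsub.eventuallyLE)
  refine setIntegral_mono_on (((integrableOn_inv_weight_mul hw (ha.trans_le ha₂)).mono_set
    fun x hx => hx.1).const_mul _) (hJint.mono_set hSsub) hSm fun x hx => ?_
  have hx' : ‖x‖ ∈ Icc a b := ⟨ha₂.trans hx.1.1, hx.1.2.trans hb₂⟩
  have hfx := hfpos x hx'
  have hwx := hwpos x hx'
  have h1 : (1 / 2 : ℝ) ^ q ≤ |u x| ^ q :=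
    Real.rpow_le_rpow (by norm_num) ((huT x hx.1 hx.2).trans (le_abs_self _)) hq.le
  have h2 : f w μ η ‖x‖ ^ t ≤ (2 * l) ^ t := Real.rpow_le_rpow hfx.le (hf _ hx.1) ht
  calc (1 / 2 : ℝ) ^ q / (2 * l) ^ t * ((w ‖x‖)⁻¹ * ‖x‖ ^ (1 - (n : ℝ)))
      = (1 / 2 : ℝ) ^ q * ‖x‖ ^ (1 - (n : ℝ)) / (w ‖x‖ * (2 * l) ^ t) := by
        field_simp
    _ ≤ |u x| ^ q * ‖x‖ ^ (1 - (n : ℝ)) / (w ‖x‖ * f w μ η ‖x‖ ^ t) := by gcongr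

/-- If `H → 0`, the weighted inequality on `B_η` forces an inequality between the measures of small
caps of the sphere. -/
theorem exists_cap_inequality (hn : 1 < n) (hp : 1 < p) (hpq : p < q) (hμ : 0 < μ) (hη : 0 < η)
    (hw : w ∈ classW) (hH : Tendsto (H w μ η) (𝓝[>] 0) (𝓝 0)) {C : ℝ} (hC : 0 < C)
    (hCKN : CKNInequality n p q w μ η C) :
    ∃ K : ℝ, 0 < K ∧ ∀ (e : EuclideanSpace ℝ (Fin n)) (r R : ℝ), 0 < r → r < R →
      0 < (sphereMeasure n).real (Metric.closedBall e r) →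
      (sphereMeasure n).real (Metric.closedBall e R) ≤
        2 * (sphereMeasure n).real (Metric.closedBall e r) →
      (sphereMeasure n).real (Metric.closedBall e r) ^ (p / q) ≤
        K * (sphereMeasure n).real (Metric.closedBall e r) := by
  obtain ⟨M, hM, hprofile⟩ := exists_radial_profile
  have hq : 0 < q := by linarith
  set t : ℝ := 1 + q / (p / (p - 1)) with ht
  have ht0 : 0 ≤ t := by
    have : 0 < p - 1 := by linarith
    have : 0 < p := by linarith
    positivity
  set c : ℝ := (1 / 2) ^ q / 2 ^ t with hc
  have hc0 : 0 < c := by positivity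
  -- `45/4 = 3 · 15/4`: two units from the doubled cap, one from the angular error, and `15/4` from
  -- `∫ dr/w` over the shell.
  refine ⟨(4 * M) ^ p * (45 / 4) / (C * c ^ (p / q)), by positivity,
    fun e r R hr hrR hm hmR => ?_⟩
  set m := (sphereMeasure n).real (Metric.closedBall e r) with hm_def
  let ψ : ContDiffBump e := ⟨r, R, hr, hrR⟩
  have hψ : ContDiff ℝ ∞ ψ := ψ.contDiff
  obtain ⟨L, hL⟩ := hψ.lipschitzWith_of_hasCompactSupport ψ.hasCompactSupport (by simp)
  set σ := (sphereMeasure n).real univ with hσ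
  have hσ0 : 0 ≤ σ := measureReal_nonneg
  -- The angular error is bounded by `θ` over the whole sphere, yet costs no more than one cap. The
  -- order of choices matters: cap, hence `L`, then `θ`, then a shell near `0`.
  obtain ⟨θ, hθ0, hθM, hθ⟩ : ∃ θ : ℝ, 0 < θ ∧ θ ≤ 2 * M ∧ θ ^ p * σ ≤ (4 * M) ^ p * m := by
    have h1 : Tendsto (fun θ : ℝ => θ ^ p * σ) (𝓝[>] 0) (𝓝 0) := by
      have : ContinuousAt (fun θ : ℝ => θ ^ p * σ) 0 :=
        (Real.continuousAt_rpow_const 0 p (Or.inr (by linarith))).mul continuousAt_const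
      have h2 := this.tendsto.mono_left (nhdsWithin_le_nhds (s := Ioi 0))
      rwa [Real.zero_rpow (by linarith), zero_mul] at h2
    obtain ⟨θ, h2, h3⟩ := ((h1.eventually_le_const
      (by positivity : 0 < (4 * M) ^ p * m)).and (Ioo_mem_nhdsGT (by positivity : 0 < 2 * M))).exists
    exact ⟨θ, h3.1, h3.2.le, h2⟩
  -- `16 = 2 · 2 · 4`, from `|k| ≤ 2`, the angular bound `2L/|x|`, and `l ≤ 4 f_η`.
  obtain ⟨r₀, hr₀, hr₀η, hsmall⟩ : ∃ r₀ : ℝ, 0 < r₀ ∧ r₀ ≤ η ∧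
      ∀ s, 0 < s → s < r₀ → 16 * L * (w s * f w μ η s / s) ≤ θ := by
    have h1 := ((tendsto_weight_mul_f_div hw hμ hη hH).const_mul (16 * (L : ℝ)))
    rw [mul_zero] at h1
    obtain ⟨r₁, hr₁, h2⟩ := mem_nhdsGT_iff_exists_Ioo_subset.1 (h1.eventually_le_const hθ0)
    exact ⟨min r₁ η, lt_min hr₁ hη, min_le_right _ _, fun s hs hs' =>
      h2 ⟨hs, hs'.trans_le (min_le_left _ _)⟩⟩
  obtain ⟨l, a, a₂, b₂, b, k, hl, ha, haa₂, hab₂, hb₂b, hbr, hfab, hfin, hint, hint₂, hk, hk0, hk2,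
    hkd, hk1⟩ := hprofile hw hη hμ hr₀ hr₀η
  have hbη : b < η := hbr.trans_le hr₀η
  have htest := isTestFunction_radial_mul_angular hψ hk hk0 ha hbη
  have hmain := hCKN _ htest
  have hψ1 : ∀ y, |ψ y| ≤ 1 := fun y => by rw [abs_of_nonneg ψ.nonneg]; exact ψ.le_one
  have hgrad : ∀ x : EuclideanSpace ℝ (Fin n), ‖x‖ ∈ Icc a b →
      ‖gradient (fun x => k ‖x‖ * ψ (‖x‖⁻¹ • x)) x‖ ≤
        (2 * M * |ψ (‖x‖⁻¹ • x)| + θ) / (l * w ‖x‖) := by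
    intro x hx
    have hx0 : 0 < ‖x‖ := ha.trans_le hx.1
    have hwx := hw.2.1 _ hx0
    have h2 : |k ‖x‖| * (2 * L / ‖x‖) ≤ θ / (l * w ‖x‖) := by
      have h3 := hsmall ‖x‖ hx0 (hx.2.trans_lt hbr)
      rw [le_div_iff₀ (by positivity)]
      calc |k ‖x‖| * (2 * L / ‖x‖) * (l * w ‖x‖)
          ≤ 2 * (2 * L / ‖x‖) * ((4 * f w μ η ‖x‖) * w ‖x‖) := by
            have := (hfab _ hx).1
            gcongr
            · exact hk2 _
            · linarith
        _ = 16 * L * (w ‖x‖ * f w μ η ‖x‖ / ‖x‖) := by ring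
        _ ≤ θ := h3
    calc _ ≤ _ := norm_gradient_radial_mul_angular_le hψ hL hk (norm_pos_iff.1 hx0)
      _ ≤ 2 * M / (l * w ‖x‖) * |ψ (‖x‖⁻¹ • x)| + θ / (l * w ‖x‖) := by
          gcongr
          exact hkd _ hx
      _ = _ := by ring
  have hup := integral_gradient_le (η := η) (T := Metric.closedBall e R) (A := 4 * M) (B := θ)
    hn hp hw ha (by linarith) hbη hl (by positivity) hθ0.le
    Metric.isClosed_closedBall.measurableSet
    (fun x hx => gradient_radial_mul_angular_eq_zero hk0 hx)
    (fun x hx _ => (hgrad x hx).trans (by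
      have hwx := hw.2.1 _ (ha.trans_le hx.1)
      gcongr
      nlinarith [hψ1 (‖x‖⁻¹ • x)]))
    (fun x hx hxT => (hgrad x hx).trans_eq (by
      rw [ψ.zero_of_le_dist (not_le.1 hxT).le, abs_zero, mul_zero, zero_add]))
  have hlow := le_integral_rpow (μ := μ) hn hq hw hη hμ ht0 ha haa₂.le hab₂.le hb₂b.le hbη hl
    (T := Metric.closedBall e r) Metric.isClosed_closedBall.measurableSet htest.1.continuous
    (fun x hx => by simp only [hk0 _ hx, zero_mul])
    (fun x hx hxT => by
      rw [ψ.one_of_mem_closedBall hxT, mul_one]; exact hk1 _ hx)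
    (fun r hr => (hfin r hr).2)
  rw [hint] at hup
  rw [hint₂, ← hm_def] at hlow
  have hlow' : c * m * l ^ (1 - t) ≤ _ := le_trans (le_of_eq ?_) hlow
  swap
  · rw [hc, Real.mul_rpow zero_le_two hl.le, Real.rpow_sub hl, Real.rpow_one]
    field_simp
  have hpow := Real.rpow_le_rpow (by positivity) hlow' (by positivity : 0 ≤ p / q)
  -- `(1 - t) p/q = -p/p' = 1 - p`, the power of `l` on the gradient side.
  have h3 : (c * m * l ^ (1 - t)) ^ (p / q) = c ^ (p / q) * m ^ (p / q) * l ^ (1 - p) := by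
    rw [Real.mul_rpow (by positivity) (by positivity), Real.mul_rpow hc0.le hm.le,
      ← Real.rpow_mul hl.le]
    congr 2
    rw [ht]
    have : p ≠ 0 := by linarith
    have : p - 1 ≠ 0 := by linarith
    field_simp
    ring
  rw [h3] at hpow
  have h4 : l ^ (-p) * ((4 * M) ^ p * (sphereMeasure n).real (Metric.closedBall e R) +
      θ ^ p * (sphereMeasure n).real univ) * (15 / 4 * l) ≤
      (4 * M) ^ p * (45 / 4) * m * l ^ (1 - p) := by
    calc _ ≤ l ^ (-p) * ((4 * M) ^ p * (2 * m) + (4 * M) ^ p * m) * (15 / 4 * l) := by gcongr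
      _ = (4 * M) ^ p * (45 / 4) * m * (l ^ (-p) * l) := by ring
      _ = _ := by
        rw [show 1 - p = -p + 1 by ring, Real.rpow_add hl, Real.rpow_one]
  have h5 : C * (c ^ (p / q) * m ^ (p / q) * l ^ (1 - p)) ≤
      (4 * M) ^ p * (45 / 4) * m * l ^ (1 - p) :=
    (mul_le_mul_of_nonneg_left hpow hC.le).trans (hmain.trans (hup.trans h4))
  have h6 : 0 < l ^ (1 - p) := Real.rpow_pos_of_pos hl _
  have h7 : C * c ^ (p / q) * m ^ (p / q) ≤ (4 * M) ^ p * (45 / 4) * m :=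
    le_of_mul_le_mul_right (by linarith) h6
  rw [div_mul_eq_mul_div, le_div_iff₀ (by positivity)]
  linarith

end CapInequality

end CKN

end

/-! ### Contradiction from shrinking caps. -/

theorem mainTheorem2 (n : ℕ) (hn : 1 < n) (p q : ℝ) (hp : 1 < p) (hpq : p < q)
    (h0 : 0 ≤ 1 / p - 1 / q) (h1 : 1 / p - 1 / q ≤ 1 / (n : ℝ))
    (μ η : ℝ) (hμ : 0 < μ) (hη : 0 < η)
    (w : ℝ → ℝ) (hw : w ∈ CKN.classW)
    (hH : Filter.Tendsto (CKN.H w μ η) (nhdsWithin 0 (Set.Ioi 0)) (nhds 0)) :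
    ¬ ∃ C : ℝ, 0 < C ∧ CKN.CKNInequality n p q w μ η C := by
  rintro ⟨C, hC, hCKN⟩
  obtain ⟨K, hK, hcap⟩ := CKN.exists_cap_inequality hn hp hpq hμ hη hw hH hC hCKN
  have hq : 0 < q := by linarith
  have hpq' : 0 < 1 - p / q := by rw [sub_pos, div_lt_one hq]; exact hpq
  let e : EuclideanSpace ℝ (Fin n) := EuclideanSpace.single ⟨0, by omega⟩ 1
  -- The threshold is chosen so that `K m^(1 - p/q) < 1`, contrary to `m^(p/q) ≤ K m`.
  obtain ⟨r, R, hr, hrR, hm, hsmall, hdouble⟩ := CKN.exists_small_cap hn (e := e) (by simp [e])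
    (by positivity : 0 < (1 / K) ^ (1 / (1 - p / q)))
  have h := hcap e r R hr hrR hm hdouble
  set m := (CKN.sphereMeasure n).real (Metric.closedBall e r)
  have h2 : m ^ (1 - p / q) < 1 / K := by
    have := Real.rpow_lt_rpow hm.le hsmall hpq'
    rwa [← Real.rpow_mul (by positivity), one_div_mul_cancel hpq'.ne', Real.rpow_one] at this
  have h3 : m = m ^ (p / q) * m ^ (1 - p / q) := by
    rw [← Real.rpow_add hm, add_sub_cancel, Real.rpow_one]
  have h4 : m < m := by
    calc m = m ^ (p / q) * m ^ (1 - p / q) := h3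
      _ < K * m * (1 / K) := by
        refine mul_lt_mul' h h2 (by positivity) (by positivity)
      _ = m := by field_simp
  exact lt_irrefl _ h4
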